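/- Let $d\in\mathbb N$ and let $\mathbb F^d$ be the free monoid of words on $d$ letters, with $\alpha^\dagger$ the reversal of the word $\alpha$. Let $\mathbb B^d_{\mathbb N}=\bigsqcup_{n}\mathbb B^d_n$ be the open noncommutative unit ball, where $\mathbb B^d_n$ is the set of $d$-tuples $Z=(Z_1,\dots,Z_d)$ of complex $n\times n$ matrices whose row $[Z_1\ \cdots\ Z_d]:\mathbb C^n\otimes\mathbb C^d\to\mathbb C^n$ has operator norm less than $1$. The free Hardy space $H^2(\mathbb B^d_{\mathbb N})$ is the Hilbert space of functions $F(Z)=\sum_{\alpha\in\mathbb F^d}F_\alpha Z^\alpha$ on $\mathbb B^d_{\mathbb N}$ with $\|F\|^2=\sum_\alpha|F_\alpha|^2<\infty$; it is identified with the full Fock space $F^2_d$, with orthonormal basis $e_\alpha\leftrightarrow Z^\alpha$, creation operators $L_ke_\alpha=e_{k\alpha}$, $R_ke_\alpha=e_{\alpha k}$ and vacuum vector $1=e_\emptyset$. A free function on $\mathbb B^d_{\mathbb N}$ is a function that maps level $n$ to $n\times n$ matrices and respects intertwinings. The left (respectively right) Schur class $\mathscr L_d$ (respectively $\mathscr R_d$)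 is the set of bounded operators on $H^2(\mathbb B^d_{\mathbb N})$ of norm at most $1$ that act as left multiplication $f(Z)\mapsto a(Z)f(Z)$ (respectively right multiplication $f(Z)\mapsto f(Z)a(Z)$) by a free function $a$. For $A\in\mathscr L_d$ put $A_\alpha=\langle L^\alpha1,A1\rangle$ and $A(Z)=\sum_\alpha A_\alpha Z^\alpha$; for $C\in\mathscr R_d$ put $C_\alpha=\langle R^\alpha1,C1\rangle$ and $C^\dagger(Z)=\sum_\alpha C_{\alpha^\dagger}Z^\alpha$ (so $A$ is left multiplication by $A(Z)$ and $C$ is right multiplication by $C^\dagger(Z)$). Theorem. Let $F\in H^2(\mathbb B^d_{\mathbb N})$ with $\|F\|_{H^2}\le1$. Then there are $A,B\in\mathscr L_d$ and $C,D\in\mathscr R_d$ with $B_\emptyset=0$ and $D_\emptyset=0$ such that for every $Z\in\mathbb B^d_{\mathbb N}$ the matrices $I-B(Z)$ and $I-D^\dagger(Z)$ are invertible and $$F(Z)=A(Z)\,(I-B(Z))^{-1}=(I-D^\dagger(Z))^{-1}\,C^\dagger(Z).$$ -/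

import Mathlib

noncomputable section

namespace FreeHardy

/-- The full Fock space over `ℂ^d`: square-summable families `(x_α)` indexed by the words `α` in the
free monoid on `d` letters, with orthonormal basis `e_α`. It is identified with the free Hardy
space of the noncommutative unit ball (norm included) through `x ↦ x(Z) = ∑ x_α Z^α`,
see `FreeHardy.eval`. -/
abbrev FockSpace (d : ℕ) : Type :=
  lp (fun _ : FreeMonoid (Fin d) => ℂ) 2

open Classical in
/-- The canonical orthonormal basis vector `e_α` of the Fock space. With the left creation operators
`L_k e_α = e_{kα}` and the right ones `R_k e_α = e_{αk}` one has `L^α 1 = e_α` and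
`R^α 1 = e_{α†}`, where `α†` is the reversed word. The vacuum vector `1` is `e_∅`. -/
def basisVec {d : ℕ} (α : FreeMonoid (Fin d)) : FockSpace d :=
  lp.single 2 α (1 : ℂ)

/-- The `n × dn` block row `[Z_1, …, Z_d]` of a `d`-tuple of `n × n` matrices. -/
def row {d n : ℕ} (Z : Fin d → Matrix (Fin n) (Fin n) ℂ) : Matrix (Fin n) (Fin d × Fin n) ℂ :=
  Matrix.of fun i p => Z p.1 i p.2

open scoped Matrix.Norms.L2Operator in
/-- Level `n` of the open noncommutative unit ball: `d`-tuples of `n × n` matrices which are strict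
row contractions, i.e. the operator norm of the row `[Z_1, …, Z_d]` from `ℂ^n ⊗ ℂ^d` to `ℂ^n` is
less than one. -/
def Ball (d n : ℕ) : Type :=
  {Z : Fin d → Matrix (Fin n) (Fin n) ℂ // ‖row Z‖ < 1}

/-- Graded functions on the noncommutative unit ball: `n × n` matrix values at level `n`. The
algebra operations are pointwise. (The level `n = 0` carries no information, since all
`0 × 0` matrices coincide.) -/
abbrev GradedFun (d : ℕ) : Type :=
  ∀ n : ℕ, Ball d n → Matrix (Fin n) (Fin n) ℂ

/-- A free (noncommutative) function: a graded function that respects intertwinings. -/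
def IsFree {d : ℕ} (f : GradedFun d) : Prop :=
  ∀ (n m : ℕ) (Z : Ball d n) (W : Ball d m) (X : Matrix (Fin n) (Fin m) ℂ),
    (∀ k, Z.1 k * X = X * W.1 k) → f n Z * X = X * f m W

/-- `Z^α = Z_{i_1} ⋯ Z_{i_k}` for the word `α = i_1 ⋯ i_k`. -/
def Ball.pow {d n : ℕ} (Z : Ball d n) (α : FreeMonoid (Fin d)) : Matrix (Fin n) (Fin n) ℂ :=
  FreeMonoid.lift Z.1 α

/-- The element `x(Z) = ∑ x_α Z^α` of the free Hardy space given by `x` in the Fock space. The series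
converges absolutely at every point of the ball, see `FreeHardy.hasSum_eval`. -/
def eval {d : ℕ} (x : FockSpace d) : GradedFun d :=
  fun _ Z => ∑' α : FreeMonoid (Fin d), x α • Z.pow α

/-- The left multiplier algebra of the free Hardy space: bounded operators `T = M^L_a` that act as
left multiplication `f(Z) ↦ a(Z) f(Z)` by a free function `a` on the ball. -/
def leftMultipliers (d : ℕ) : Set (FockSpace d →L[ℂ] FockSpace d) :=
  {T | ∃ a : GradedFun d, IsFree a ∧ ∀ x, eval (T x) = a * eval x}

/-- The right multiplier algebra of the free Hardy space: bounded operators `T = M^R_a` that act as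
right multiplication `f(Z) ↦ f(Z) a(Z)` by a free function `a` on the ball. -/
def rightMultipliers (d : ℕ) : Set (FockSpace d →L[ℂ] FockSpace d) :=
  {T | ∃ a : GradedFun d, IsFree a ∧ ∀ x, eval (T x) = eval x * a}

/-- The left Schur class: the closed unit ball of the left multiplier algebra. -/
def leftSchur (d : ℕ) : Set (FockSpace d →L[ℂ] FockSpace d) :=
  {T | T ∈ leftMultipliers d ∧ ‖T‖ ≤ 1}

/-- The right Schur class: the closed unit ball of the right multiplier algebra. -/
def rightSchur (d : ℕ) : Set (FockSpace d →L[ℂ] FockSpace d) :=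
  {T | T ∈ rightMultipliers d ∧ ‖T‖ ≤ 1}

/-- The coefficient `A_α = ⟨L^α 1, A 1⟩` of the left free Fourier series `A(L) = ∑ A_α L^α`. -/
def leftCoeff {d : ℕ} (A : FockSpace d →L[ℂ] FockSpace d) (α : FreeMonoid (Fin d)) : ℂ :=
  inner ℂ (basisVec α) (A (basisVec 1))

/-- The coefficient `C_α = ⟨R^α 1, C 1⟩` of the right free Fourier series `C(R) = ∑ C_α R^α`. -/
def rightCoeff {d : ℕ} (C : FockSpace d →L[ℂ] FockSpace d) (α : FreeMonoid (Fin d)) : ℂ :=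
  inner ℂ (basisVec α.reverse) (C (basisVec 1))

/-- The function `A(Z) = ∑ A_α Z^α` of an operator with left free Fourier series
`A(L) = ∑ A_α L^α`. -/
def leftFun {d : ℕ} (A : FockSpace d →L[ℂ] FockSpace d) : GradedFun d :=
  fun _ Z => ∑' α : FreeMonoid (Fin d), leftCoeff A α • Z.pow α

/-- The function `C†(Z) = ∑ C_{α†} Z^α` of an operator with right free Fourier series
`C(R) = ∑ C_α R^α`. -/
def rightDagger {d : ℕ} (C : FockSpace d →L[ℂ] FockSpace d) : GradedFun d :=
  fun _ Z => ∑' α : FreeMonoid (Fin d), rightCoeff C α.reverse • Z.pow α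

/-- Pairing with a basis vector reads off a coordinate. -/
theorem inner_basisVec {d : ℕ} (α : FreeMonoid (Fin d)) (x : FockSpace d) :
    inner ℂ (basisVec α) x = x α := by
  simp [basisVec, lp.inner_single_left]

/-- `A(Z)` is the image in the free Hardy space of the symbol `A 1`. -/
theorem leftFun_eq_eval {d : ℕ} (A : FockSpace d →L[ℂ] FockSpace d) :
    leftFun A = eval (A (basisVec 1)) := by
  funext n Z
  simp [leftFun, eval, leftCoeff, inner_basisVec]

/-- `C†(Z)` is the image in the free Hardy space of the symbol `C 1`. -/
theorem rightDagger_eq_eval {d : ℕ} (C : FockSpace d →L[ℂ] FockSpace d) :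
    rightDagger C = eval (C (basisVec 1)) := by
  funext n Z
  simp [rightDagger, eval, rightCoeff, inner_basisVec]

/-- The words of length at most `N`. -/
def words (d : ℕ) : ℕ → Finset (FreeMonoid (Fin d))
  | 0 => {1}
  | N + 1 => by
      classical
      exact insert 1 ((Finset.univ ×ˢ words d N).image fun p => FreeMonoid.of p.1 * p.2)

theorem one_mem_words (d N : ℕ) : 1 ∈ words d N := by
  cases N <;> simp [words]

theorem words_succ (d N : ℕ) : words d N ⊆ words d (N + 1) := by
  induction N with
  | zero => simp [words]
  | succ N ih =>
    intro α h
    rw [words] at h ⊢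
    simp only [Finset.mem_insert, Finset.mem_image, Finset.mem_product, Finset.mem_univ,
      true_and, Prod.exists] at h ⊢
    rcases h with h | ⟨i, β, hβ, h⟩
    · exact Or.inl h
    · exact Or.inr ⟨i, β, ih hβ, h⟩

theorem exists_mem_words {d : ℕ} (α : FreeMonoid (Fin d)) : ∃ N, α ∈ words d N := by
  induction α using FreeMonoid.inductionOn' with
  | one => exact ⟨0, one_mem_words d 0⟩
  | of_mul i β ih =>
    obtain ⟨N, hN⟩ := ih
    refine ⟨N + 1, ?_⟩
    rw [words]
    simp only [Finset.mem_insert, Finset.mem_image, Finset.mem_product, Finset.mem_univ,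
      true_and, Prod.exists]
    exact Or.inr ⟨i, β, hN, rfl⟩

theorem exists_subset_words {d : ℕ} (s : Finset (FreeMonoid (Fin d))) : ∃ N, s ⊆ words d N := by
  classical
  have hm : Monotone (words d) := monotone_nat_of_le_succ (words_succ d)
  induction s using Finset.induction_on with
  | empty => exact ⟨0, by simp⟩
  | insert α s _ ih =>
    obtain ⟨N, hN⟩ := ih
    obtain ⟨M, hM⟩ := exists_mem_words α
    refine ⟨max M N, Finset.insert_subset (hm (le_max_left M N) hM) ?_⟩
    exact hN.trans (hm (le_max_right M N))

open scoped Matrix.Norms.L2Operator in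
theorem sum_vecMul_row_le {d n : ℕ} (Z : Fin d → Matrix (Fin n) (Fin n) ℂ) (v : Fin n → ℂ) :
    ∑ k, ∑ j, ‖Matrix.vecMul v (Z k) j‖ ^ 2 ≤ ‖row Z‖ ^ 2 * ∑ j, ‖v j‖ ^ 2 := by
  have h := Matrix.l2_opNorm_mulVec (row Z).conjTranspose (WithLp.toLp 2 (star v))
  have h2 := mul_self_le_mul_self (norm_nonneg _) h
  rw [Matrix.l2_opNorm_conjTranspose, mul_mul_mul_comm, ← sq, ← sq, ← sq,
    EuclideanSpace.norm_sq_eq, EuclideanSpace.norm_sq_eq, Fintype.sum_prod_type] at h2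
  have e : ∀ (k : Fin d) (j : Fin n),
      ‖Matrix.mulVec (row Z).conjTranspose (star v) (k, j)‖ = ‖Matrix.vecMul v (Z k) j‖ := by
    intro k j
    rw [← Matrix.star_vecMul, Pi.star_apply, norm_star]
    rfl
  simpa [e] using h2

open scoped Matrix.Norms.L2Operator in
theorem sum_words_le {d n : ℕ} (Z : Ball d n) (N : ℕ) (v : Fin n → ℂ) :
    ∑ α ∈ words d N, ∑ j, ‖Matrix.vecMul v (Z.pow α) j‖ ^ 2
      ≤ (1 - ‖row Z.1‖ ^ 2)⁻¹ * ∑ j, ‖v j‖ ^ 2 := by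
  classical
  have hr : 0 < 1 - ‖row Z.1‖ ^ 2 := by
    have := Z.2
    nlinarith [norm_nonneg (row Z.1)]
  induction N generalizing v with
  | zero =>
    have hv : 0 ≤ ∑ j, ‖v j‖ ^ 2 := Finset.sum_nonneg fun _ _ => by positivity
    have h1 : 1 ≤ (1 - ‖row Z.1‖ ^ 2)⁻¹ := by
      rw [one_le_inv₀ hr]; nlinarith [norm_nonneg (row Z.1)]
    simpa [words, Ball.pow] using le_mul_of_one_le_left hv h1
  | succ N ih =>
    have hv : 0 ≤ ∑ j, ‖v j‖ ^ 2 := Finset.sum_nonneg fun _ _ => by positivity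
    have hinj : Function.Injective
        (fun p : Fin d × FreeMonoid (Fin d) => FreeMonoid.of p.1 * p.2) := by
      rintro ⟨i, β⟩ ⟨j, γ⟩ h
      have h' : i :: FreeMonoid.toList β = j :: FreeMonoid.toList γ := h
      injection h' with h1 h2
      exact Prod.ext h1 h2
    have hnot : (1 : FreeMonoid (Fin d)) ∉
        (Finset.univ ×ˢ words d N).image (fun p => FreeMonoid.of p.1 * p.2) := by
      simp only [Finset.mem_image, not_exists, not_and]
      intro p _ h
      have := congrArg FreeMonoid.length h
      simp at this
    rw [words, Finset.sum_insert hnot, Finset.sum_image (fun _ _ _ _ h => hinj h),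
      Finset.sum_product]
    have key : ∑ k, ∑ β ∈ words d N, ∑ j, ‖Matrix.vecMul v (Z.pow (FreeMonoid.of k * β)) j‖ ^ 2
        ≤ (1 - ‖row Z.1‖ ^ 2)⁻¹ * (‖row Z.1‖ ^ 2 * ∑ j, ‖v j‖ ^ 2) := by
      refine le_trans (Finset.sum_le_sum (g := fun k =>
        (1 - ‖row Z.1‖ ^ 2)⁻¹ * ∑ j, ‖Matrix.vecMul v (Z.1 k) j‖ ^ 2) fun k _ => ?_) ?_
      · have := ih (Matrix.vecMul v (Z.1 k))
        simpa [Ball.pow, Matrix.vecMul_vecMul] using this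
      · rw [← Finset.mul_sum]
        exact mul_le_mul_of_nonneg_left (sum_vecMul_row_le Z.1 v) (inv_nonneg.2 hr.le)
    have e1 : ∑ j, ‖Matrix.vecMul v (Z.pow 1) j‖ ^ 2 = ∑ j, ‖v j‖ ^ 2 := by simp [Ball.pow]
    rw [e1]
    refine (add_le_add le_rfl key).trans (le_of_eq ?_)
    field_simp
    ring

/-- Absolute convergence of the series that defines `eval`, entry by entry. -/
theorem summable_norm_eval {d n : ℕ} (x : FockSpace d) (Z : Ball d n) (i j : Fin n) :
    Summable fun α : FreeMonoid (Fin d) => ‖x α * Z.pow α i j‖ := by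
  have hx : Summable fun α => ‖x α‖ ^ 2 := by
    have := (lp.memℓp x).summable (by norm_num)
    simpa using this
  have hZ : Summable fun α : FreeMonoid (Fin d) => ‖Z.pow α i j‖ ^ 2 := by
    refine summable_of_sum_le (fun _ => by positivity) (fun s => ?_)
      (c := (1 - @norm _ (Matrix.instL2OpNormedAddCommGroup).toNorm (row Z.1) ^ 2)⁻¹ *
        ∑ k, ‖(Pi.single i (1 : ℂ) : Fin n → ℂ) k‖ ^ 2)
    obtain ⟨N, hN⟩ := exists_subset_words s
    refine le_trans ?_ (sum_words_le Z N (Pi.single i 1))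
    refine le_trans (Finset.sum_le_sum_of_subset_of_nonneg hN fun _ _ _ => by positivity) ?_
    refine Finset.sum_le_sum fun α _ => ?_
    have := Finset.single_le_sum (f := fun k =>
      ‖Matrix.vecMul (Pi.single i (1 : ℂ)) (Z.pow α) k‖ ^ 2)
      (fun _ _ => by positivity) (Finset.mem_univ j)
    simpa using this
  refine Summable.of_nonneg_of_le (fun _ => norm_nonneg _) (fun α => ?_) (hx.add hZ)
  rw [norm_mul]
  nlinarith [sq_nonneg (‖x α‖ - ‖Z.pow α i j‖), sq_nonneg (‖x α‖ + ‖Z.pow α i j‖)]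

theorem hasSum_eval {d n : ℕ} (x : FockSpace d) (Z : Ball d n) :
    HasSum (fun α : FreeMonoid (Fin d) => x α • Z.pow α) (eval x n Z) := by
  refine Summable.hasSum ?_
  refine Pi.summable.2 fun i => Pi.summable.2 fun j => ?_
  exact (summable_norm_eval x Z i j).of_norm

end FreeHardy

end

noncomputable section

namespace FreeHardy

variable {d : ℕ}

/-! Work first with formal power series, and seek `F = a h⁻¹` with `b = 1 - h`. Take `h = g⁻¹`,
where `g = (1 + H) / 2` is built so that the Gram matrix of the right translates `F z^α`, plus `(1 -
‖F‖²) I`, equals `T + T* - I`, with `T` the matrix of left multiplication by `g`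
(`inner_fockShift_eq`). Thus `b` is the Cayley transform `(H - 1)(H + 1)⁻¹`. As a quadratic form the
identity reads `‖F y‖² + (1 - ‖F‖²) ‖y‖² = 2 Re ⟨y, g y⟩ - ‖y‖²` (`norm_sq_sum_fockShift`). For `y =
h u` one has `g y = u`, so the right side is `‖u‖² - ‖u - y‖²`, and `‖a u‖² + ‖b u‖² ≤ ‖u‖²` with `a
= F h` (`exists_contractive_column`). A priori `h` is only formal, so this is proved on truncations
by word length; contractivity there yields bounded multipliers.

Since `b` has no constant term, the vectors `B^k 1` start in degree `k`. They have norm at most `1`,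
hence tend weakly to zero. Point evaluations are inner products with kernel vectors, so `B(Z)^k →
0`, and `1` is not an eigenvalue of `B(Z)`.

The right factorisation is the left one for `F` with all words reversed. -/

/-! ### Formal power series in noncommuting variables -/

open Classical in
/-- The finite set of factorisations of a word into a prefix and a suffix. -/
def splits (α : FreeMonoid (Fin d)) : Finset (FreeMonoid (Fin d) × FreeMonoid (Fin d)) :=
  (Finset.range (α.length + 1)).image fun i =>
    (FreeMonoid.ofList (α.toList.take i), FreeMonoid.ofList (α.toList.drop i))

@[simp]
theorem mem_splits {α : FreeMonoid (Fin d)} {p : FreeMonoid (Fin d) × FreeMonoid (Fin d)} :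
    p ∈ splits α ↔ p.1 * p.2 = α := by
  obtain ⟨β, γ⟩ := p
  simp only [splits, Finset.mem_image, Finset.mem_range, Prod.mk.injEq]
  constructor
  · rintro ⟨i, -, rfl, rfl⟩
    exact List.take_append_drop i α.toList
  · rintro rfl
    refine ⟨β.length, ?_, ?_, ?_⟩
    · rw [FreeMonoid.length_mul]; omega
    · exact List.take_left (l₁ := β.toList) (l₂ := γ.toList)
    · exact List.drop_left (l₁ := β.toList) (l₂ := γ.toList)

/-- The product of two formal power series in noncommuting variables, in terms of their
coefficients. -/
def conv (f g : FreeMonoid (Fin d) → ℂ) (α : FreeMonoid (Fin d)) : ℂ :=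
  ∑ p ∈ splits α, f p.1 * g p.2

theorem conv_assoc (f g h : FreeMonoid (Fin d) → ℂ) :
    conv (conv f g) h = conv f (conv g h) := by
  funext α
  simp only [conv, Finset.sum_mul, Finset.mul_sum, Finset.sum_sigma']
  refine Finset.sum_nbij' (fun x => ⟨(x.2.1, x.2.2 * x.1.2), (x.2.2, x.1.2)⟩)
    (fun x => ⟨(x.1.1 * x.2.1, x.2.2), (x.1.1, x.2.1)⟩) ?_ ?_ ?_ ?_ ?_
  · rintro ⟨⟨a, b⟩, ⟨c, e⟩⟩ h
    simp only [Finset.mem_sigma, mem_splits, and_true] at h ⊢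
    rw [← h.1, ← h.2, mul_assoc]
  · rintro ⟨⟨a, b⟩, ⟨c, e⟩⟩ h
    simp only [Finset.mem_sigma, mem_splits, and_true] at h ⊢
    rw [← h.1, ← h.2, mul_assoc]
  · rintro ⟨⟨a, b⟩, ⟨c, e⟩⟩ h
    simp only [Finset.mem_sigma, mem_splits] at h
    simp [h.2]
  · rintro ⟨⟨a, b⟩, ⟨c, e⟩⟩ h
    simp only [Finset.mem_sigma, mem_splits] at h
    simp [h.2]
  · intro x _
    exact mul_assoc _ _ _

theorem conv_sub_left (f g h : FreeMonoid (Fin d) → ℂ) :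
    conv (f - g) h = conv f h - conv g h := by
  funext α
  simp [conv, sub_mul]

theorem conv_sub_right (f g h : FreeMonoid (Fin d) → ℂ) :
    conv f (g - h) = conv f g - conv f h := by
  funext α
  simp [conv, mul_sub]

theorem conv_add_right (f g h : FreeMonoid (Fin d) → ℂ) :
    conv f (g + h) = conv f g + conv f h := by
  funext α
  simp [conv, mul_add, Finset.sum_add_distrib]

theorem conv_smul_right (c : ℂ) (f g : FreeMonoid (Fin d) → ℂ) :
    conv f (c • g) = c • conv f g := by
  funext α
  simp [conv, Finset.mul_sum, mul_left_comm]

theorem basisVec_self (α : FreeMonoid (Fin d)) : (basisVec α : FockSpace d) α = 1 := by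
  simp [basisVec]

theorem basisVec_of_ne {α β : FreeMonoid (Fin d)} (h : β ≠ α) :
    (basisVec α : FockSpace d) β = 0 := by
  simp [basisVec, h]

theorem conv_one_left (f : FreeMonoid (Fin d) → ℂ) : conv (basisVec 1 : FockSpace d) f = f := by
  funext α
  rw [conv, Finset.sum_eq_single (1, α)]
  · simp [basisVec_self]
  · rintro ⟨β, γ⟩ h hne
    rw [mem_splits] at h
    rw [basisVec_of_ne, zero_mul]
    rintro rfl
    exact hne (by simpa using h)
  · intro h
    exact absurd (by simp) h

theorem conv_one_right (f : FreeMonoid (Fin d) → ℂ) : conv f (basisVec 1 : FockSpace d) = f := by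
  funext α
  rw [conv, Finset.sum_eq_single (α, 1)]
  · simp [basisVec_self]
  · rintro ⟨β, γ⟩ h hne
    rw [mem_splits] at h
    rw [basisVec_of_ne, mul_zero]
    rintro rfl
    exact hne (by simpa using h)
  · intro h
    exact absurd (by simp) h

/-- Reversal is an anti-automorphism of words, so it swaps the factors. This transfers left
multiplication results to the right. -/
theorem conv_reverse (f g : FreeMonoid (Fin d) → ℂ) (α : FreeMonoid (Fin d)) :
    conv f g α.reverse = conv (fun β => g β.reverse) (fun β => f β.reverse) α := by
  rw [conv, conv]
  refine Finset.sum_nbij' (fun p => (p.2.reverse, p.1.reverse))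
    (fun p => (p.2.reverse, p.1.reverse)) ?_ ?_ ?_ ?_ ?_
  · rintro ⟨β, γ⟩ h
    rw [mem_splits] at h ⊢
    rw [← FreeMonoid.reverse_mul, h, FreeMonoid.reverse_reverse]
  · rintro ⟨β, γ⟩ h
    rw [mem_splits] at h ⊢
    rw [← FreeMonoid.reverse_mul, h]
  · simp
  · simp
  · simp [mul_comm]

@[simp]
theorem mem_words {N : ℕ} {α : FreeMonoid (Fin d)} : α ∈ words d N ↔ α.length ≤ N := by
  induction N generalizing α with
  | zero => simp [words, FreeMonoid.length_eq_zero]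
  | succ N ih =>
    rw [words]
    simp only [Finset.mem_insert, Finset.mem_image, Finset.mem_product, Finset.mem_univ,
      true_and, Prod.exists, ih]
    constructor
    · rintro (rfl | ⟨i, β, h, rfl⟩)
      · simp
      · rw [FreeMonoid.length_mul, FreeMonoid.length_of]; omega
    · intro h
      induction α using FreeMonoid.casesOn with
      | one => exact Or.inl rfl
      | of_mul i β =>
        rw [FreeMonoid.length_mul, FreeMonoid.length_of] at h
        exact Or.inr ⟨i, β, by omega, rfl⟩

/-- Multiplication is triangular for word length: a suffix is never longer than the word. Hence
truncation is harmless for the low coefficients. -/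
theorem conv_congr_right {N : ℕ} {f u v : FreeMonoid (Fin d) → ℂ}
    (h : ∀ α ∈ words d N, u α = v α) {α : FreeMonoid (Fin d)} (hα : α ∈ words d N) :
    conv f u α = conv f v α := by
  refine Finset.sum_congr rfl fun p hp => ?_
  rw [mem_splits] at hp
  rw [h p.2]
  rw [mem_words, ← hp, FreeMonoid.length_mul] at hα
  rw [mem_words]
  omega

open Classical in
/-- A right inverse of a formal power series with constant term `1`. -/
def rightInv (g : FreeMonoid (Fin d) → ℂ) (α : FreeMonoid (Fin d)) : ℂ :=
  if α = 1 then 1 else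
    -- `attach` and the dependent `if` hand the termination proof what it needs: `p` splits `α` with
    -- nonempty prefix, so its suffix is shorter. The constant term of `g` is never read.
    -∑ p ∈ (splits α).attach, if _h : p.1.1 = 1 then 0 else g p.1.1 * rightInv g p.1.2
termination_by α.length
decreasing_by
  have h1 := p.2
  rw [mem_splits] at h1
  have h2 : p.1.1.length ≠ 0 := fun h => _h (FreeMonoid.length_eq_zero.1 h)
  have h3 : p.1.1.length + p.1.2.length = α.length := by rw [← FreeMonoid.length_mul, h1]
  omega

theorem rightInv_one (g : FreeMonoid (Fin d) → ℂ) : rightInv g 1 = 1 := by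
  rw [rightInv, if_pos rfl]

theorem conv_rightInv {g : FreeMonoid (Fin d) → ℂ} (hg : g 1 = 1) :
    conv g (rightInv g) = (basisVec 1 : FockSpace d) := by
  classical
  funext α
  have hmem : ((1 : FreeMonoid (Fin d)), α) ∈ splits α := by simp
  -- Isolate the factorisation with empty prefix: as `g 1 = 1`, its term is `rightInv g α`, which
  -- the recursion sets to cancel all the others.
  rw [conv, ← Finset.add_sum_erase _ _ hmem]
  by_cases hα : α = 1
  · subst hα
    rw [basisVec_self, hg, rightInv_one, Finset.sum_eq_zero]
    · simp
    · rintro ⟨β, γ⟩ h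
      rw [Finset.mem_erase, mem_splits] at h
      have h3 : β.length + γ.length = 0 := by rw [← FreeMonoid.length_mul, h.2]; simp
      have hβ : β = 1 := FreeMonoid.length_eq_zero.1 (by omega)
      have hγ : γ = 1 := FreeMonoid.length_eq_zero.1 (by omega)
      exact absurd (by rw [hβ, hγ]) h.1
  · rw [basisVec_of_ne hα]
    dsimp only
    rw [hg, one_mul]
    conv_lhs => rw [rightInv, if_neg hα]
    rw [Finset.sum_attach (splits α)
      (fun p => if _h : p.1 = 1 then 0 else g p.1 * rightInv g p.2),
      ← Finset.add_sum_erase _ _ hmem, dif_pos rfl, zero_add, neg_add_eq_zero]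
    refine Finset.sum_congr rfl fun p hp => ?_
    rw [Finset.mem_erase, mem_splits] at hp
    rw [dif_neg]
    intro h
    refine hp.1 (Prod.ext h ?_)
    rw [← hp.2, h, one_mul]

/-! ### Right translation by words, on series and on the Fock space -/

/-- The series `f z^β`, in terms of the coefficients of `f`. -/
def shift (β : FreeMonoid (Fin d)) (f : FreeMonoid (Fin d) → ℂ) : FreeMonoid (Fin d) → ℂ :=
  Function.extend (· * β) f 0

theorem mul_right_injective_word (β : FreeMonoid (Fin d)) :
    Function.Injective (fun γ : FreeMonoid (Fin d) => γ * β) :=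
  fun _ _ h => List.append_cancel_right h

@[simp]
theorem shift_mul (β γ : FreeMonoid (Fin d)) (f : FreeMonoid (Fin d) → ℂ) :
    shift β f (γ * β) = f γ :=
  (mul_right_injective_word β).extend_apply f 0 γ

theorem shift_eq_zero {α β : FreeMonoid (Fin d)} (f : FreeMonoid (Fin d) → ℂ)
    (h : ∀ γ, γ * β ≠ α) : shift β f α = 0 :=
  Function.extend_apply' _ _ _ fun ⟨γ, hγ⟩ => h γ hγ

theorem shift_self (α : FreeMonoid (Fin d)) (f : FreeMonoid (Fin d) → ℂ) :
    shift α f α = f 1 := by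
  simpa using shift_mul α 1 f

theorem shift_shift (α β : FreeMonoid (Fin d)) (f : FreeMonoid (Fin d) → ℂ) :
    shift (α * β) f = shift β (shift α f) := by
  funext w
  by_cases h : ∃ γ, γ * β = w
  · obtain ⟨γ, rfl⟩ := h
    rw [shift_mul]
    by_cases h' : ∃ δ, δ * α = γ
    · obtain ⟨δ, rfl⟩ := h'
      rw [shift_mul, mul_assoc, shift_mul]
    · push Not at h'
      rw [shift_eq_zero f h', shift_eq_zero]
      intro δ h
      rw [← mul_assoc] at h
      exact h' δ (mul_right_injective_word β h)
  · push Not at h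
    rw [shift_eq_zero _ h, shift_eq_zero]
    intro δ h'
    exact h (δ * α) (by rw [mul_assoc, h'])

open Classical in
theorem shift_eq_sum (α β : FreeMonoid (Fin d)) (f : FreeMonoid (Fin d) → ℂ) :
    shift β f α = ∑ p ∈ splits α, if p.2 = β then f p.1 else 0 := by
  by_cases h : ∃ γ, γ * β = α
  · obtain ⟨γ, rfl⟩ := h
    rw [shift_mul, Finset.sum_eq_single (γ, β)]
    · simp
    · rintro ⟨γ', β'⟩ h hne
      rw [mem_splits] at h
      refine if_neg ?_
      rintro rfl
      exact hne (Prod.ext (mul_right_injective_word _ h) rfl)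
    · intro h
      exact absurd (by simp) h
  · push Not at h
    rw [shift_eq_zero f h, Finset.sum_eq_zero]
    rintro ⟨γ', β'⟩ h'
    rw [mem_splits] at h'
    refine if_neg ?_
    rintro rfl
    exact h _ h'

theorem conv_eq_sum_shift {S : Finset (FreeMonoid (Fin d))} {y : FreeMonoid (Fin d) → ℂ}
    (hy : ∀ β ∉ S, y β = 0) (g : FreeMonoid (Fin d) → ℂ) (α : FreeMonoid (Fin d)) :
    conv g y α = ∑ β ∈ S, y β * shift β g α := by
  classical
  simp_rw [shift_eq_sum, Finset.mul_sum]
  rw [Finset.sum_comm, conv]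
  refine Finset.sum_congr rfl fun p _ => ?_
  simp only [mul_ite, mul_zero, Finset.sum_ite_eq]
  split_ifs with h
  · exact mul_comm _ _
  · rw [hy _ h, mul_zero]

/-- Two suffixes of one word are comparable. This is what makes incomparable translates orthogonal.
-/
theorem eq_mul_or_eq_mul_of_mul_eq_mul {α β γ δ : FreeMonoid (Fin d)} (h : γ * α = δ * β) :
    (∃ ε, ε * α = β) ∨ ∃ ε, ε * β = α := by
  have h1 : α.toList <:+ (γ * α).toList := ⟨γ.toList, rfl⟩
  have h2 : β.toList <:+ (γ * α).toList := ⟨δ.toList, by rw [h]; rfl⟩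
  exact List.suffix_or_suffix_of_suffix h1 h2

theorem sum_norm_sq_le (x : FockSpace d) (s : Finset (FreeMonoid (Fin d))) :
    ∑ α ∈ s, ‖x α‖ ^ 2 ≤ ‖x‖ ^ 2 := by
  have := lp.sum_rpow_le_norm_rpow (p := 2) (by norm_num) x s
  simpa using this

theorem memℓp_two_of_sum_le {f : FreeMonoid (Fin d) → ℂ} {C : ℝ}
    (h : ∀ s : Finset (FreeMonoid (Fin d)), ∑ α ∈ s, ‖f α‖ ^ 2 ≤ C) : Memℓp f 2 :=
  memℓp_gen' (C := C) fun s => by simpa using h s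

theorem norm_le_of_sum_norm_sq_le {x : FockSpace d} {C : ℝ} (hC : 0 ≤ C)
    (h : ∀ s : Finset (FreeMonoid (Fin d)), ∑ α ∈ s, ‖x α‖ ^ 2 ≤ C ^ 2) : ‖x‖ ≤ C :=
  lp.norm_le_of_forall_sum_le (p := 2) (by norm_num) hC fun s => by simpa using h s

theorem memℓp_shift (β : FreeMonoid (Fin d)) (x : FockSpace d) :
    Memℓp (shift β x : FreeMonoid (Fin d) → ℂ) 2 := by
  refine (memℓp_gen_iff (by norm_num)).2 ?_
  refine ((mul_right_injective_word β).summable_iff ?_).1 ?_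
  · intro α hα
    rw [shift_eq_zero _ fun γ h => hα ⟨γ, h⟩]
    simp
  · refine ((lp.memℓp x).summable (by norm_num)).congr fun γ => ?_
    simp

/-- The element `f(Z) Z^β` of the free Hardy space. -/
def fockShift (β : FreeMonoid (Fin d)) (x : FockSpace d) : FockSpace d :=
  ⟨shift β x, memℓp_shift β x⟩

theorem coe_fockShift (β : FreeMonoid (Fin d)) (x : FockSpace d) :
    (fockShift β x : FreeMonoid (Fin d) → ℂ) = shift β x := rfl

theorem inner_fockShift_fockShift (β : FreeMonoid (Fin d)) (x y : FockSpace d) :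
    inner ℂ (fockShift β x) (fockShift β y) = inner ℂ x y := by
  rw [lp.inner_eq_tsum, lp.inner_eq_tsum]
  rw [← (mul_right_injective_word β).tsum_eq]
  · simp [coe_fockShift]
  · intro α hα
    by_contra h
    refine hα ?_
    dsimp only
    rw [coe_fockShift, shift_eq_zero _ fun γ h' => h ⟨γ, h'⟩, inner_zero_left]

theorem fockShift_mul (α β : FreeMonoid (Fin d)) (x : FockSpace d) :
    fockShift (α * β) x = fockShift β (fockShift α x) :=
  lp.ext (shift_shift α β x)

/-- The supports are disjoint: a word ending in both `α` and `β` would make one a suffix of the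
other. -/
theorem inner_fockShift_eq_zero {α β : FreeMonoid (Fin d)} (x y : FockSpace d)
    (h1 : ∀ γ, γ * α ≠ β) (h2 : ∀ γ, γ * β ≠ α) :
    inner ℂ (fockShift α x) (fockShift β y) = 0 := by
  rw [lp.inner_eq_tsum, ← tsum_zero (α := ℂ) (β := FreeMonoid (Fin d))]
  congr 1
  funext w
  rw [coe_fockShift, coe_fockShift]
  by_cases hα : ∃ γ, γ * α = w
  · by_cases hβ : ∃ δ, δ * β = w
    · obtain ⟨γ, hγ⟩ := hα
      obtain ⟨δ, hδ⟩ := hβ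
      rcases eq_mul_or_eq_mul_of_mul_eq_mul (hγ.trans hδ.symm) with ⟨ε, h⟩ | ⟨ε, h⟩
      · exact absurd h (h1 ε)
      · exact absurd h (h2 ε)
    · push Not at hβ
      rw [shift_eq_zero _ hβ, inner_zero_right]
  · push Not at hα
    rw [shift_eq_zero _ hα, inner_zero_left]

/-! ### The Herglotz series and the contractive column -/

open Classical in
/-- The coefficients of `(1 + H) / 2`, where `H` is the free Herglotz function with `H(0) = 1` whose
real part is the Toeplitz form of left multiplication by `f` plus a multiple of the identity. -/
def herglotz (f : FockSpace d) (γ : FreeMonoid (Fin d)) : ℂ :=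
  if γ = 1 then 1 else inner ℂ (fockShift γ f) f

theorem herglotz_one (f : FockSpace d) : herglotz f 1 = 1 := if_pos rfl

theorem not_mul_eq_of_ne_one {γ β : FreeMonoid (Fin d)} (h : γ ≠ 1) (δ : FreeMonoid (Fin d)) :
    δ * (γ * β) ≠ β := by
  intro h'
  refine h (FreeMonoid.length_eq_zero.1 ?_)
  have := congrArg FreeMonoid.length h'
  simp only [FreeMonoid.length_mul] at this
  omega

theorem inner_fockShift_mul (f : FockSpace d) {γ : FreeMonoid (Fin d)} (h : γ ≠ 1)
    (β : FreeMonoid (Fin d)) :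
    inner ℂ (fockShift (γ * β) f) (fockShift β f) = herglotz f γ := by
  rw [fockShift_mul, inner_fockShift_fockShift, herglotz, if_neg h]

-- Off the diagonal at most one of the two shift terms survives, according to which word is a suffix
-- of the other. On the diagonal both sides equal `1`, which is why `herglotz f 1` is `1` and not
-- `‖f‖ ^ 2`.
open Classical in
theorem inner_fockShift_eq (f : FockSpace d) (α β : FreeMonoid (Fin d)) :
    inner ℂ (fockShift α f) (fockShift β f) + (if α = β then 1 - (‖f‖ : ℂ) ^ 2 else 0)
      = shift β (herglotz f) α + star (shift α (herglotz f) β) - (if α = β then 1 else 0) := by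
  by_cases hαβ : α = β
  · subst hαβ
    rw [if_pos rfl, if_pos rfl, inner_fockShift_fockShift, shift_self, herglotz_one,
      inner_self_eq_norm_sq_to_K]
    simp
  rw [if_neg hαβ, if_neg hαβ, add_zero, sub_zero]
  by_cases h1 : ∃ γ, γ * β = α
  · obtain ⟨γ, rfl⟩ := h1
    have hγ : γ ≠ 1 := fun h => hαβ (by rw [h, one_mul])
    rw [inner_fockShift_mul f hγ, shift_mul, shift_eq_zero _ (not_mul_eq_of_ne_one hγ)]
    simp
  by_cases h2 : ∃ γ, γ * α = β
  · obtain ⟨γ, rfl⟩ := h2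
    have hγ : γ ≠ 1 := fun h => hαβ (by rw [h, one_mul])
    rw [← inner_conj_symm, inner_fockShift_mul f hγ, shift_mul,
      shift_eq_zero _ (not_mul_eq_of_ne_one hγ)]
    simp
  push Not at h1 h2
  rw [inner_fockShift_eq_zero f f h2 h1, shift_eq_zero _ h1, shift_eq_zero _ h2]
  simp

theorem sum_fockShift_apply {S : Finset (FreeMonoid (Fin d))} {y : FreeMonoid (Fin d) → ℂ}
    (hy : ∀ β ∉ S, y β = 0) (f : FockSpace d) :
    (∑ β ∈ S, y β • fockShift β f : FockSpace d) = conv f y := by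
  funext α
  rw [conv_eq_sum_shift hy, lp.coeFn_sum, Finset.sum_apply]
  rfl

theorem norm_sq_sum_fockShift {S : Finset (FreeMonoid (Fin d))} {y : FreeMonoid (Fin d) → ℂ}
    (hy : ∀ β ∉ S, y β = 0) (f : FockSpace d) :
    ‖∑ β ∈ S, y β • fockShift β f‖ ^ 2 + (1 - ‖f‖ ^ 2) * ∑ α ∈ S, ‖y α‖ ^ 2
      = 2 * (∑ α ∈ S, star (y α) * conv (herglotz f) y α).re - ∑ α ∈ S, ‖y α‖ ^ 2 := by
  classical
  have hsq : ∀ α, ((‖y α‖ ^ 2 : ℝ) : ℂ) = star (y α) * y α := fun α => by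
    rw [Complex.star_def, Complex.conj_mul']; push_cast; rfl
  have hdiag : ∀ c : ℂ, ∑ α ∈ S, ∑ β ∈ S, star (y α) * y β * (if α = β then c else 0)
      = c * ∑ α ∈ S, ((‖y α‖ ^ 2 : ℝ) : ℂ) := by
    intro c
    rw [Finset.mul_sum]
    refine Finset.sum_congr rfl fun α hα => ?_
    simp only [mul_ite, mul_zero, Finset.sum_ite_eq, if_pos hα, hsq]
    ring
  have hT : ∑ α ∈ S, star (y α) * conv (herglotz f) y α
      = ∑ α ∈ S, ∑ β ∈ S, star (y α) * y β * shift β (herglotz f) α := by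
    refine Finset.sum_congr rfl fun α _ => ?_
    rw [conv_eq_sum_shift hy, Finset.mul_sum]
    exact Finset.sum_congr rfl fun β _ => by ring
  have hT' : star (∑ α ∈ S, star (y α) * conv (herglotz f) y α)
      = ∑ α ∈ S, ∑ β ∈ S, star (y α) * y β * star (shift α (herglotz f) β) := by
    rw [hT, Finset.sum_comm, star_sum]
    refine Finset.sum_congr rfl fun α _ => ?_
    rw [star_sum]
    refine Finset.sum_congr rfl fun β _ => ?_
    simp only [star_mul', star_star]
    ring
  have hN : ((‖∑ β ∈ S, y β • fockShift β f‖ ^ 2 : ℝ) : ℂ)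
      = ∑ α ∈ S, ∑ β ∈ S, star (y α) * y β * inner ℂ (fockShift α f) (fockShift β f) := by
    have h := inner_self_eq_norm_sq_to_K (𝕜 := ℂ) (∑ β ∈ S, y β • fockShift β f)
    push_cast
    refine Eq.trans h.symm ?_
    rw [sum_inner]
    refine Finset.sum_congr rfl fun α _ => ?_
    rw [inner_sum]
    refine Finset.sum_congr rfl fun β _ => ?_
    rw [inner_smul_left, inner_smul_right, Complex.star_def]
    ring
  have hre : ((2 * (∑ α ∈ S, star (y α) * conv (herglotz f) y α).re : ℝ) : ℂ)
      = (∑ α ∈ S, star (y α) * conv (herglotz f) y α)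
        + star (∑ α ∈ S, star (y α) * conv (herglotz f) y α) := by
    rw [Complex.star_def, Complex.add_conj]
  -- Over `ℂ` both sides are double sums over `S`, scalar multiples of the identity included
  -- (`hdiag`), and they agree entry by entry by `inner_fockShift_eq`.
  apply Complex.ofReal_injective
  rw [Complex.ofReal_add, Complex.ofReal_sub, hre, hT', hT, hN, Complex.ofReal_mul,
    Complex.ofReal_sum, Complex.ofReal_sub, Complex.ofReal_one, Complex.ofReal_pow, ← hdiag]
  have h1 := hdiag 1
  rw [one_mul] at h1
  rw [← h1]
  simp only [← Finset.sum_add_distrib, ← Finset.sum_sub_distrib, ← mul_add, ← mul_sub,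
    inner_fockShift_eq]

/-- Every element of the unit ball of the free Hardy space is a quotient `a h⁻¹`, with `h(0) = 1`,
such that the column with entries `a` and `1 - h` is contractive on truncated power series. -/
theorem exists_contractive_column (f : FockSpace d) (hf : ‖f‖ ≤ 1) :
    ∃ h : FreeMonoid (Fin d) → ℂ, h 1 = 1 ∧ ∀ (N : ℕ) (u : FreeMonoid (Fin d) → ℂ),
      ∑ α ∈ words d N, ‖conv (conv f h) u α‖ ^ 2 + ∑ α ∈ words d N, ‖u α - conv h u α‖ ^ 2
        ≤ ∑ α ∈ words d N, ‖u α‖ ^ 2 := by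
  classical
  set g := herglotz f with hg
  refine ⟨rightInv g, rightInv_one g, fun N u => ?_⟩
  set h := rightInv g
  -- The test vector is `h u` cut off at length `N`: the quadratic identity needs finite support,
  -- and by triangularity `g y = u` still holds up to length `N`.
  set y : FreeMonoid (Fin d) → ℂ := fun α => if α ∈ words d N then conv h u α else 0 with hy
  have hyS : ∀ β ∉ words d N, y β = 0 := fun β hβ => if_neg hβ
  have hyE : ∀ β ∈ words d N, y β = conv h u β := fun β hβ => if_pos hβ
  have hgy : ∀ α ∈ words d N, conv g y α = u α := fun α hα => by
    rw [conv_congr_right hyE hα, ← conv_assoc, conv_rightInv (herglotz_one f), conv_one_left]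
  have hfy : ∀ α ∈ words d N, conv f y α = conv (conv f h) u α := fun α hα => by
    rw [conv_congr_right hyE hα, conv_assoc]
  have key := norm_sq_sum_fockShift hyS f
  have hle := sum_norm_sq_le (∑ β ∈ words d N, y β • fockShift β f) (words d N)
  rw [sum_fockShift_apply hyS] at hle
  have e1 : ∑ α ∈ words d N, ‖conv (conv f h) u α‖ ^ 2 = ∑ α ∈ words d N, ‖conv f y α‖ ^ 2 :=
    Finset.sum_congr rfl fun α hα => by rw [hfy α hα]
  -- Expand `‖u - y‖²`; since `u = g y` on these words, the cross term is the one in `key`.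
  have e2 : ∑ α ∈ words d N, ‖u α - conv h u α‖ ^ 2
      = ∑ α ∈ words d N, ‖u α‖ ^ 2 - 2 * (∑ α ∈ words d N, star (y α) * conv g y α).re
        + ∑ α ∈ words d N, ‖y α‖ ^ 2 := by
    rw [Complex.re_sum, Finset.mul_sum, ← Finset.sum_sub_distrib, ← Finset.sum_add_distrib]
    refine Finset.sum_congr rfl fun α hα => ?_
    rw [hgy α hα, ← hyE α hα, Complex.sq_norm, Complex.sq_norm, Complex.sq_norm,
      Complex.normSq_sub, mul_comm (u α), Complex.star_def]
    ring
  have hpos : 0 ≤ (1 - ‖f‖ ^ 2) * ∑ α ∈ words d N, ‖y α‖ ^ 2 :=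
    mul_nonneg (by nlinarith [norm_nonneg f]) (Finset.sum_nonneg fun _ _ => by positivity)
  rw [e1, e2]
  linarith

/-! ### Evaluation on the ball: free functions and products -/

theorem Ball.pow_mul {n : ℕ} (Z : Ball d n) (α β : FreeMonoid (Fin d)) :
    Z.pow (α * β) = Z.pow α * Z.pow β :=
  map_mul (FreeMonoid.lift Z.1) α β

theorem hasSum_eval_apply {n : ℕ} (x : FockSpace d) (Z : Ball d n) (i j : Fin n) :
    HasSum (fun α : FreeMonoid (Fin d) => x α * Z.pow α i j) (eval x n Z i j) :=
  Pi.hasSum.1 (Pi.hasSum.1 (hasSum_eval x Z) i) j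

theorem isFree_eval (x : FockSpace d) : IsFree (eval x) := by
  intro n m Z W X h
  have hpow : ∀ α : FreeMonoid (Fin d), Z.pow α * X = X * W.pow α := by
    intro α
    induction α using FreeMonoid.inductionOn' with
    | one => simp [Ball.pow]
    | of_mul k α ih =>
      rw [Ball.pow_mul, Ball.pow_mul, Matrix.mul_assoc, ih, ← Matrix.mul_assoc,
        ← Matrix.mul_assoc]
      congr 1
      simpa [Ball.pow] using h k
  ext i j
  have h1 := hasSum_sum (s := Finset.univ) fun k _ =>
    (hasSum_eval_apply x Z i k).mul_right (X k j)
  have h2 := hasSum_sum (s := Finset.univ) fun k _ =>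
    (hasSum_eval_apply x W k j).mul_left (X i k)
  rw [Matrix.mul_apply, Matrix.mul_apply]
  refine h1.unique ?_
  convert h2 using 2 with α
  have := congrArg (x α * ·) (congrFun (congrFun (hpow α) i) j)
  simp only [Matrix.mul_apply, Finset.mul_sum] at this
  simpa only [mul_assoc, mul_left_comm] using this

/-- Pairs of words, grouped by their product. -/
def sigmaSplitsEquiv (d : ℕ) : (Σ α : FreeMonoid (Fin d), {p // p ∈ splits α}) ≃
    FreeMonoid (Fin d) × FreeMonoid (Fin d) where
  toFun x := x.2.1
  invFun p := ⟨p.1 * p.2, p, mem_splits.2 rfl⟩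
  left_inv := by
    rintro ⟨α, p, h⟩
    obtain rfl := mem_splits.1 h
    rfl
  right_inv _ := rfl

theorem hasSum_sum_splits {φ : FreeMonoid (Fin d) × FreeMonoid (Fin d) → ℂ} {c : ℂ}
    (h : HasSum φ c) : HasSum (fun α => ∑ p ∈ splits α, φ p) c :=
  HasSum.sigma ((sigmaSplitsEquiv d).hasSum_iff.2 h) fun α => (splits α).hasSum φ

theorem hasSum_eval_mul_eval_apply {n : ℕ} (x y : FockSpace d) (Z : Ball d n) (i j : Fin n) :
    HasSum (fun p : FreeMonoid (Fin d) × FreeMonoid (Fin d) =>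
      x p.1 * y p.2 * Z.pow (p.1 * p.2) i j) ((eval x n Z * eval y n Z) i j) := by
  have hk : ∀ k, HasSum (fun p : FreeMonoid (Fin d) × FreeMonoid (Fin d) =>
      (x p.1 * Z.pow p.1 i k) * (y p.2 * Z.pow p.2 k j)) (eval x n Z i k * eval y n Z k j) :=
    fun k => HasSum.mul (f := fun α => x α * Z.pow α i k) (g := fun α => y α * Z.pow α k j)
      (hasSum_eval_apply x Z i k) (hasSum_eval_apply y Z k j)
      (summable_mul_of_summable_norm (f := fun α => x α * Z.pow α i k)
        (g := fun α => y α * Z.pow α k j) (summable_norm_eval x Z i k)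
        (summable_norm_eval y Z k j))
  rw [Matrix.mul_apply]
  have hsum := hasSum_sum (s := Finset.univ) fun k _ => hk k
  have hφ : ∀ p : FreeMonoid (Fin d) × FreeMonoid (Fin d), x p.1 * y p.2 * Z.pow (p.1 * p.2) i j
      = ∑ k, (x p.1 * Z.pow p.1 i k) * (y p.2 * Z.pow p.2 k j) := fun p => by
    rw [Ball.pow_mul, Matrix.mul_apply, Finset.mul_sum]
    exact Finset.sum_congr rfl fun k _ => by ring
  simp only [hφ]
  exact hsum

/-- Absolute convergence lets the double series be regrouped by the product word. The formal product
of two Fock space elements need not be square-summable, hence the separate `z`. -/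
theorem eval_conv {x y z : FockSpace d} (h : (z : FreeMonoid (Fin d) → ℂ) = conv x y) :
    eval z = eval x * eval y := by
  funext n Z
  ext i j
  have hz := hasSum_sum_splits (hasSum_eval_mul_eval_apply x y Z i j)
  refine (hasSum_eval_apply z Z i j).unique ?_
  have e : ∀ α, z α * Z.pow α i j
      = ∑ p ∈ splits α, x p.1 * y p.2 * Z.pow (p.1 * p.2) i j := fun α => by
    rw [h, conv, Finset.sum_mul]
    exact Finset.sum_congr rfl fun p hp => by rw [mem_splits.1 hp]
  simp only [e]
  exact hz

theorem eval_sub (x y : FockSpace d) : eval (x - y) = eval x - eval y := by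
  funext n Z
  refine (hasSum_eval (x - y) Z).unique ?_
  have h := (hasSum_eval x Z).sub (hasSum_eval y Z)
  simp only [← sub_smul] at h
  exact h

theorem eval_one : eval (basisVec 1 : FockSpace d) = 1 := by
  funext n Z
  refine (hasSum_eval _ Z).unique ?_
  have := hasSum_single (f := fun α => (basisVec 1 : FockSpace d) α • Z.pow α) 1
    fun α hα => by rw [basisVec_of_ne hα, zero_smul]
  simpa [basisVec_self, Ball.pow] using this

/-! ### From truncation-contractive series to Schur class operators -/

/-- A linear map on formal power series that is contractive on all truncations. -/
def IsTruncContraction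
    (T : (FreeMonoid (Fin d) → ℂ) →ₗ[ℂ] (FreeMonoid (Fin d) → ℂ)) : Prop :=
  ∀ N u, ∑ α ∈ words d N, ‖T u α‖ ^ 2 ≤ ∑ α ∈ words d N, ‖u α‖ ^ 2

theorem IsTruncContraction.sum_le
    {T : (FreeMonoid (Fin d) → ℂ) →ₗ[ℂ] (FreeMonoid (Fin d) → ℂ)} (hT : IsTruncContraction T)
    (x : FockSpace d) (s : Finset (FreeMonoid (Fin d))) : ∑ α ∈ s, ‖T x α‖ ^ 2 ≤ ‖x‖ ^ 2 := by
  obtain ⟨N, hN⟩ := exists_subset_words s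
  exact (Finset.sum_le_sum_of_subset_of_nonneg hN fun _ _ _ => by positivity).trans
    ((hT N x).trans (sum_norm_sq_le x _))

/-- The contraction on the Fock space induced by a truncation-contractive map. -/
def IsTruncContraction.toCLM
    {T : (FreeMonoid (Fin d) → ℂ) →ₗ[ℂ] (FreeMonoid (Fin d) → ℂ)} (hT : IsTruncContraction T) :
    FockSpace d →L[ℂ] FockSpace d :=
  LinearMap.mkContinuous
    { toFun := fun x => ⟨T x, memℓp_two_of_sum_le (hT.sum_le x)⟩
      map_add' := fun x y => lp.ext (map_add T (x : FreeMonoid (Fin d) → ℂ) y)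
      map_smul' := fun c x => lp.ext (map_smul T c (x : FreeMonoid (Fin d) → ℂ)) }
    1 fun x => by
      rw [one_mul]
      exact norm_le_of_sum_norm_sq_le (norm_nonneg x) (hT.sum_le x)

theorem IsTruncContraction.coe_toCLM
    {T : (FreeMonoid (Fin d) → ℂ) →ₗ[ℂ] (FreeMonoid (Fin d) → ℂ)} (hT : IsTruncContraction T)
    (x : FockSpace d) : (hT.toCLM x : FreeMonoid (Fin d) → ℂ) = T x := rfl

theorem IsTruncContraction.norm_toCLM_le
    {T : (FreeMonoid (Fin d) → ℂ) →ₗ[ℂ] (FreeMonoid (Fin d) → ℂ)} (hT : IsTruncContraction T) :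
    ‖hT.toCLM‖ ≤ 1 :=
  LinearMap.mkContinuous_norm_le _ zero_le_one _

/-- Left multiplication by a formal power series. -/
def convLeft (b : FreeMonoid (Fin d) → ℂ) :
    (FreeMonoid (Fin d) → ℂ) →ₗ[ℂ] (FreeMonoid (Fin d) → ℂ) where
  toFun := conv b
  map_add' := conv_add_right b
  map_smul' c u := conv_smul_right c b u

/-- Right multiplication by a formal power series. -/
def convRight (b : FreeMonoid (Fin d) → ℂ) :
    (FreeMonoid (Fin d) → ℂ) →ₗ[ℂ] (FreeMonoid (Fin d) → ℂ) where
  toFun u := conv u b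
  map_add' u v := by
    funext α
    simp [conv, add_mul, Finset.sum_add_distrib]
  map_smul' c u := by
    funext α
    simp [conv, Finset.mul_sum, mul_assoc]

theorem convRight_reverse {b : FreeMonoid (Fin d) → ℂ} (hb : IsTruncContraction (convLeft b)) :
    IsTruncContraction (convRight fun α => b α.reverse) := by
  intro N u
  have hrev : ∀ v : FreeMonoid (Fin d) → ℝ,
      ∑ α ∈ words d N, v α.reverse = ∑ α ∈ words d N, v α := fun v =>
    Finset.sum_nbij' FreeMonoid.reverse FreeMonoid.reverse (by simp) (by simp) (by simp)
      (by simp) (by simp)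
  -- Reversal preserves length, so it permutes `words d N` and leaves both truncated norms
  -- unchanged.
  have h := hb N fun α => u α.reverse
  rw [hrev fun α => ‖u α‖ ^ 2, ← hrev] at h
  refine le_trans (le_of_eq (Finset.sum_congr rfl fun α _ => ?_)) h
  change _ = ‖conv b _ α.reverse‖ ^ 2
  rw [conv_reverse]
  simp only [FreeMonoid.reverse_reverse]
  rfl

variable {b : FreeMonoid (Fin d) → ℂ}

theorem coe_toCLM_convLeft_one (hb : IsTruncContraction (convLeft b)) :
    (hb.toCLM (basisVec 1) : FreeMonoid (Fin d) → ℂ) = b :=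
  conv_one_right b

theorem coe_toCLM_convRight_one (hb : IsTruncContraction (convRight b)) :
    (hb.toCLM (basisVec 1) : FreeMonoid (Fin d) → ℂ) = b :=
  conv_one_left b

theorem eval_toCLM_convLeft (hb : IsTruncContraction (convLeft b)) (x : FockSpace d) :
    eval (hb.toCLM x) = eval (hb.toCLM (basisVec 1)) * eval x := by
  refine eval_conv ?_
  rw [coe_toCLM_convLeft_one]
  rfl

theorem eval_toCLM_convRight (hb : IsTruncContraction (convRight b)) (x : FockSpace d) :
    eval (hb.toCLM x) = eval x * eval (hb.toCLM (basisVec 1)) := by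
  refine eval_conv ?_
  rw [coe_toCLM_convRight_one]
  rfl

theorem toCLM_convLeft_mem (hb : IsTruncContraction (convLeft b)) : hb.toCLM ∈ leftSchur d :=
  ⟨⟨_, isFree_eval _, eval_toCLM_convLeft hb⟩, hb.norm_toCLM_le⟩

theorem toCLM_convRight_mem (hb : IsTruncContraction (convRight b)) : hb.toCLM ∈ rightSchur d :=
  ⟨⟨_, isFree_eval _, eval_toCLM_convRight hb⟩, hb.norm_toCLM_le⟩

/-! ### Kernel vectors and invertibility of one minus a multiplier -/

theorem summable_norm_sq_pow {n : ℕ} (Z : Ball d n) (i j : Fin n) :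
    Summable fun α : FreeMonoid (Fin d) => ‖Z.pow α i j‖ ^ 2 := by
  refine summable_of_sum_le (fun _ => by positivity) (fun s => ?_)
    (c := (1 - @norm _ (Matrix.instL2OpNormedAddCommGroup).toNorm (row Z.1) ^ 2)⁻¹ *
      ∑ k, ‖(Pi.single i (1 : ℂ) : Fin n → ℂ) k‖ ^ 2)
  obtain ⟨N, hN⟩ := exists_subset_words s
  refine le_trans ?_ (sum_words_le Z N (Pi.single i 1))
  refine (Finset.sum_le_sum_of_subset_of_nonneg hN fun _ _ _ => by positivity).trans ?_
  refine Finset.sum_le_sum fun α _ => ?_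
  have := Finset.single_le_sum (f := fun k =>
    ‖Matrix.vecMul (Pi.single i (1 : ℂ)) (Z.pow α) k‖ ^ 2)
    (fun _ _ => by positivity) (Finset.mem_univ j)
  simpa using this

/-- The reproducing vector of the functional `x ↦ x(Z)_{ij}`. -/
def kernelVec {n : ℕ} (Z : Ball d n) (i j : Fin n) : FockSpace d :=
  ⟨fun α => star (Z.pow α i j), (memℓp_gen_iff (by norm_num)).2 <| by
    simpa using summable_norm_sq_pow Z i j⟩

theorem inner_kernelVec {n : ℕ} (Z : Ball d n) (i j : Fin n) (x : FockSpace d) :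
    inner ℂ (kernelVec Z i j) x = eval x n Z i j := by
  refine (lp.hasSum_inner _ _).unique ?_
  have h : ∀ α, inner ℂ (kernelVec Z i j α) (x α) = x α * Z.pow α i j := fun α => by
    rw [RCLike.inner_apply]
    exact congrArg (x α * ·) (star_star (Z.pow α i j))
  simp only [h]
  exact hasSum_eval_apply x Z i j

open Filter Topology

/-- Bounded sequences whose coefficients vanish eventually converge weakly to zero. -/
theorem tendsto_inner_zero {x : ℕ → FockSpace d} (hx : ∀ k, ‖x k‖ ≤ 1)
    (hx0 : ∀ k α, FreeMonoid.length α < k → x k α = 0) (z : FockSpace d) :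
    Tendsto (fun k => inner ℂ z (x k)) atTop (𝓝 0) := by
  classical
  rw [Metric.tendsto_atTop]
  intro ε hε
  have hz := lp.hasSum_single (p := 2) (by norm_num) z
  obtain ⟨s, hs⟩ := (Metric.tendsto_atTop.1 hz) ε hε
  obtain ⟨N, hN⟩ := exists_subset_words s
  refine ⟨N + 1, fun k hk => ?_⟩
  -- A finite partial sum of `z` only involves words of length at most `N`, where `x k` vanishes;
  -- the remainder of `z` has norm below `ε`.
  have h0 : inner ℂ (∑ α ∈ s, lp.single 2 α (z α) : FockSpace d) (x k) = 0 := by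
    rw [sum_inner]
    refine Finset.sum_eq_zero fun α hα => ?_
    have := mem_words.1 (hN hα)
    rw [lp.inner_single_left, hx0 k α (by omega), inner_zero_right]
  have h1 := hs s le_rfl
  rw [dist_comm, dist_eq_norm] at h1
  rw [dist_zero_right, ← sub_zero (inner ℂ z (x k)), ← h0, ← inner_sub_left]
  refine (norm_inner_le_norm _ _).trans_lt
    ((mul_le_of_le_one_right (norm_nonneg _) (hx k)).trans_lt h1)

/-- Otherwise `M` fixes a nonzero vector, and so do all its powers, which contradicts the limit. No
norm bound on `M` is needed. -/
theorem isUnit_one_sub_of_pow_tendsto_zero {n : ℕ} {M : Matrix (Fin n) (Fin n) ℂ}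
    (h : Tendsto (fun k => M ^ k) atTop (𝓝 0)) : IsUnit (1 - M) := by
  rw [Matrix.isUnit_iff_isUnit_det, isUnit_iff_ne_zero]
  intro hdet
  obtain ⟨v, hv, hMv⟩ := Matrix.exists_mulVec_eq_zero_iff.2 hdet
  rw [Matrix.sub_mulVec, Matrix.one_mulVec, sub_eq_zero] at hMv
  have hpow : ∀ k, (M ^ k).mulVec v = v := by
    intro k
    induction k with
    | zero => simp
    | succ k ih => rw [pow_succ, ← Matrix.mulVec_mulVec, ← hMv, ih]
  have hlim : Tendsto (fun k => (M ^ k).mulVec v) atTop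
      (𝓝 ((0 : Matrix (Fin n) (Fin n) ℂ).mulVec v)) :=
    ((Continuous.matrix_mulVec continuous_id continuous_const).tendsto _).comp h
  simp only [hpow, Matrix.zero_mulVec] at hlim
  exact hv (tendsto_nhds_unique tendsto_const_nhds hlim)

theorem isUnit_one_sub_of_eval_eq_pow {x : ℕ → FockSpace d} (hx : ∀ k, ‖x k‖ ≤ 1)
    (hx0 : ∀ k α, FreeMonoid.length α < k → x k α = 0) {n : ℕ} {Z : Ball d n}
    {M : Matrix (Fin n) (Fin n) ℂ} (hM : ∀ k, eval (x k) n Z = M ^ k) : IsUnit (1 - M) := by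
  refine isUnit_one_sub_of_pow_tendsto_zero ?_
  refine tendsto_pi_nhds.2 fun i => tendsto_pi_nhds.2 fun j => ?_
  have h := tendsto_inner_zero hx hx0 (kernelVec Z i j)
  simp only [inner_kernelVec, hM] at h
  exact h

theorem norm_basisVec (α : FreeMonoid (Fin d)) : ‖(basisVec α : FockSpace d)‖ = 1 := by
  simp [basisVec]

theorem norm_pow_apply_le {T : FockSpace d →L[ℂ] FockSpace d} (hT : ‖T‖ ≤ 1) (k : ℕ) :
    ‖(T ^ k) (basisVec 1)‖ ≤ 1 := by
  induction k with
  | zero => simp [norm_basisVec]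
  | succ k ih =>
    rw [pow_succ', mul_apply_eq_comp]
    exact (T.le_of_opNorm_le hT _).trans (by rwa [one_mul])

theorem isUnit_one_sub_eval_left (hb : IsTruncContraction (convLeft b)) (hb1 : b 1 = 0)
    {n : ℕ} (Z : Ball d n) : IsUnit (1 - eval (hb.toCLM (basisVec 1)) n Z) := by
  refine isUnit_one_sub_of_eval_eq_pow (Z := Z) (norm_pow_apply_le hb.norm_toCLM_le) ?_ ?_
  · intro k
    induction k with
    | zero => simp
    | succ k ih =>
      intro α hα
      rw [pow_succ', mul_apply_eq_comp, hb.coe_toCLM]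
      change ∑ p ∈ splits α, _ = _
      refine Finset.sum_eq_zero fun p hp => ?_
      rw [mem_splits] at hp
      -- Degree grows by one at each step: the empty prefix is killed by `b 1 = 0`, and any other
      -- prefix leaves a suffix short enough for `ih`.
      by_cases h : p.1 = 1
      · rw [h, hb1, zero_mul]
      · rw [ih, mul_zero]
        rw [← FreeMonoid.length_eq_zero] at h
        rw [← hp, FreeMonoid.length_mul] at hα
        omega
  · intro k
    induction k with
    | zero => simp [eval_one]
    | succ k ih =>
      rw [pow_succ', mul_apply_eq_comp, eval_toCLM_convLeft, pow_succ', ← ih]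
      rfl

theorem isUnit_one_sub_eval_right (hb : IsTruncContraction (convRight b)) (hb1 : b 1 = 0)
    {n : ℕ} (Z : Ball d n) : IsUnit (1 - eval (hb.toCLM (basisVec 1)) n Z) := by
  refine isUnit_one_sub_of_eval_eq_pow (Z := Z) (norm_pow_apply_le hb.norm_toCLM_le) ?_ ?_
  · intro k
    induction k with
    | zero => simp
    | succ k ih =>
      intro α hα
      rw [pow_succ', mul_apply_eq_comp, hb.coe_toCLM]
      change ∑ p ∈ splits α, _ = _
      refine Finset.sum_eq_zero fun p hp => ?_
      rw [mem_splits] at hp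
      by_cases h : p.2 = 1
      · rw [h, hb1, mul_zero]
      · rw [ih, zero_mul]
        rw [← FreeMonoid.length_eq_zero] at h
        rw [← hp, FreeMonoid.length_mul] at hα
        omega
  · intro k
    induction k with
    | zero => simp [eval_one]
    | succ k ih =>
      rw [pow_succ', mul_apply_eq_comp, eval_toCLM_convRight, pow_succ, ← ih]
      rfl

/-! ### The factorisation and its mirror image -/

/-- The coefficientwise form of the factorisation `f = a (1 - b)⁻¹`. -/
theorem exists_truncContraction_factors (f : FockSpace d) (hf : ‖f‖ ≤ 1) :
    ∃ a b : FreeMonoid (Fin d) → ℂ, IsTruncContraction (convLeft a) ∧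
      IsTruncContraction (convLeft b) ∧ b 1 = 0 ∧ a = f - conv f b := by
  obtain ⟨h, h1, hcol⟩ := exists_contractive_column f hf
  refine ⟨conv f h, (basisVec 1 : FockSpace d) - h, fun N u => ?_, fun N u => ?_, ?_, ?_⟩
  · exact le_trans (le_add_of_nonneg_right (Finset.sum_nonneg fun _ _ => by positivity)) (hcol N u)
  · refine le_trans (le_of_eq (Finset.sum_congr rfl fun α _ => ?_))
      (le_trans (le_add_of_nonneg_left (Finset.sum_nonneg fun _ _ => by positivity)) (hcol N u))
    change ‖conv _ u α‖ ^ 2 = _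
    rw [conv_sub_left, conv_one_left]
    rfl
  · rw [Pi.sub_apply, basisVec_self, h1, sub_self]
  · rw [conv_sub_right, conv_one_right, sub_sub_cancel]

/-- The element of the free Hardy space with all words reversed. -/
def fockReverse (x : FockSpace d) : FockSpace d :=
  ⟨fun α => x α.reverse, (memℓp_gen_iff (by norm_num)).2 <|
    (Equiv.summable_iff (f := fun α => ‖x α‖ ^ (2 : ENNReal).toReal)
      (Function.Involutive.toPerm FreeMonoid.reverse fun _ => FreeMonoid.reverse_reverse)).2
    ((lp.memℓp x).summable (by norm_num))⟩

theorem norm_fockReverse_le (x : FockSpace d) : ‖fockReverse x‖ ≤ ‖x‖ := by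
  classical
  refine norm_le_of_sum_norm_sq_le (norm_nonneg x) fun s => ?_
  refine le_trans (le_of_eq ?_) (sum_norm_sq_le x (s.image FreeMonoid.reverse))
  rw [Finset.sum_image fun α _ β _ h => by
    rw [← FreeMonoid.reverse_reverse (a := α), h, FreeMonoid.reverse_reverse]]
  rfl

end FreeHardy

end

open FreeHardy in
theorem theorem6p3 (d : ℕ) (F : FockSpace d) (hF : ‖F‖ ≤ 1) :
    ∃ A ∈ leftSchur d, ∃ B ∈ leftSchur d, ∃ C ∈ rightSchur d, ∃ D ∈ rightSchur d,
      leftCoeff B 1 = 0 ∧ rightCoeff D 1 = 0 ∧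
      ∀ (n : ℕ) (Z : Ball d n),
        IsUnit (1 - leftFun B n Z) ∧
        IsUnit (1 - rightDagger D n Z) ∧
        eval F n Z = leftFun A n Z * (1 - leftFun B n Z)⁻¹ ∧
        eval F n Z = (1 - rightDagger D n Z)⁻¹ * rightDagger C n Z := by
  obtain ⟨a, b, ha, hb, hb1, hab⟩ := exists_truncContraction_factors F hF
  obtain ⟨c, e, hc, he, he1, hce⟩ := exists_truncContraction_factors (fockReverse F)
    ((norm_fockReverse_le F).trans hF)
  have hc' := convRight_reverse hc
  have he' := convRight_reverse he
  have he1' : e (FreeMonoid.reverse 1) = 0 := he1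
  -- The formal product `F b` equals `F - a`, hence lies in the Fock space, and `eval_conv` applies.
  have hA : eval (F - ha.toCLM (basisVec 1)) = eval F * eval (hb.toCLM (basisVec 1)) := by
    refine eval_conv ?_
    rw [lp.coeFn_sub, coe_toCLM_convLeft_one, coe_toCLM_convLeft_one, hab, sub_sub_cancel]
  -- Reversing `c = F† - F† e`, with `F†` the reversed `F`, puts the reversed `e` to the left of
  -- `F`.
  have hC : eval (F - hc'.toCLM (basisVec 1)) = eval (he'.toCLM (basisVec 1)) * eval F := by
    refine eval_conv ?_
    rw [lp.coeFn_sub, coe_toCLM_convRight_one, coe_toCLM_convRight_one]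
    funext α
    rw [Pi.sub_apply, hce, Pi.sub_apply, conv_reverse]
    simp [fockReverse]
  refine ⟨_, toCLM_convLeft_mem ha, _, toCLM_convLeft_mem hb, _, toCLM_convRight_mem hc', _,
    toCLM_convRight_mem he', ?_, ?_, fun n Z => ?_⟩
  · rw [leftCoeff, inner_basisVec, coe_toCLM_convLeft_one, hb1]
  · rw [rightCoeff, inner_basisVec, coe_toCLM_convRight_one]
    exact he1
  · simp only [leftFun_eq_eval, rightDagger_eq_eval]
    have uB := isUnit_one_sub_eval_left hb hb1 Z
    have uD := isUnit_one_sub_eval_right he' he1' Z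
    refine ⟨uB, uD, ?_, ?_⟩
    · have h := congrFun (congrFun hA n) Z
      rw [eval_sub] at h
      have h' : eval (ha.toCLM (basisVec 1)) n Z
          = eval F n Z * (1 - eval (hb.toCLM (basisVec 1)) n Z) := by
        rw [mul_sub, mul_one]
        refine Eq.trans ?_ (congrArg (eval F n Z - ·) h)
        exact (sub_sub_cancel _ _).symm
      rw [h', Matrix.mul_nonsing_inv_cancel_right _ _ ((Matrix.isUnit_iff_isUnit_det _).1 uB)]
    · have h := congrFun (congrFun hC n) Z
      rw [eval_sub] at h
      have h' : eval (hc'.toCLM (basisVec 1)) n Z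
          = (1 - eval (he'.toCLM (basisVec 1)) n Z) * eval F n Z := by
        rw [sub_mul, one_mul]
        refine Eq.trans ?_ (congrArg (eval F n Z - ·) h)
        exact (sub_sub_cancel _ _).symm
      rw [h', Matrix.nonsing_inv_mul_cancel_left _ _ ((Matrix.isUnit_iff_isUnit_det _).1 uD)]
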